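/- Let $G$ be a connected undirected weighted graph with finite or countable vertex set $V$ and symmetric weight $w:V\times V\to[0,\infty)$, $w(v,v)=0$, whose weighted degrees $\sum_{u}w(v,u)$ are finite and uniformly bounded in $v$; the edges are the pairs $(u,v)$ with $w(u,v)\neq 0$. Let $L$ be the bounded self-adjoint nonnegative operator $(Lf)(v)=\sum_{u}(f(v)-f(u))\,w(v,u)$ on $\ell^2(V)$ (complex-valued functions), and for $\omega>0$ let $PW_\omega(L)$ be the image of the spectral projection $\mathbf 1_{[0,\omega]}(L)$. Let $\{S_j\}_{j\in J}$ be a cover of $V$ by finite sets, each with more than one vertex and inducing a connected subgraph, such that no edge has both of its ends in $S_i$ and also both of its ends in $S_j$ for $i\ne j$. Let $\lambda_{1,j}$ be the first nonzero eigenvalue of the Laplacian of the induced subgraph on $S_j$, and let $\chi_j$ be the characteristic function of $S_j$. For each $j$ let $\psi_j\in\ell^2(V)$ be supported in $S_j$, put $\Psi_j(f)=\langle f,\psi_j\rangle$, and assume $\Psi_j(\chi_j)\neq0$. Set $$\theta_j=\frac{|S_j|\,\|\psi_j\|^2}{|\Psi_j(\chi_j)|^2},\qquad \Theta_\Xi=\sup_{j}\theta_j,\qquad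 \Lambda_{\mathcal S}=\inf_{j}\lambda_{1,j},$$ and assume $\Theta_\Xi<\infty$ and $\Lambda_{\mathcal S}>0$. Let $\omega>0$, $\epsilon>0$ and $c,C\in\mathbb R$ be such that $$\gamma=(1+\epsilon)\frac{\Theta_\Xi}{\Lambda_{\mathcal S}}\,\omega<1,\qquad \frac{|S_j|^2}{|\Psi_j(\chi_j)|^2}\le c,\qquad \|\psi_j\|^2\le C\qquad\text{for all } j\in J.$$ Then the functionals $\{\Psi_j\}_{j\in J}$ form a frame on $PW_\omega(L)$, that is, there are constants $A,B>0$ with $A\|f\|^2\le\sum_{j}|\Psi_j(f)|^2\le B\|f\|^2$ for all $f\in PW_\omega(L)$. Moreover, for every $f\in PW_\omega(L)$, $$\frac{(1-\gamma)\epsilon}{(1+\epsilon)c}\,\|f\|^2\le\sum_{j\in J}|\Psi_j(f)|^2<\infty,$$ and, if the sets $S_j$ are pairwise disjoint, $$\sum_{j\in J}|\Psi_j(f)|^2\le C\,\|f\|^2 .$$ -/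

import Mathlib

open Filter Topology

noncomputable section

/-- `ℓ²` of a vertex set: square summable complex-valued functions. -/
abbrev EllTwo (V : Type*) : Type _ := lp (fun _ : V => ℂ) 2

/-- An undirected weighted graph on the vertex set `V`, in which every vertex has finite weighted
degree. The edges are the pairs of vertices of nonzero weight. -/
structure WeightedGraph (V : Type*) where
  /-- the weight function -/
  w : V → V → ℝ
  nonneg : ∀ u v, 0 ≤ w u v
  symm : ∀ u v, w u v = w v u
  loopless : ∀ v, w v v = 0
  summable : ∀ v, Summable (w v)

namespace WeightedGraph

variable {V : Type*}

/-- The weighted degree of a vertex. -/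
def deg (G : WeightedGraph V) (v : V) : ℝ := ∑' u, G.w v u

/-- The weighted degrees are uniformly bounded. -/
def BoundedDegree (G : WeightedGraph V) : Prop := ∃ D : ℝ, ∀ v, G.deg v ≤ D

/-- The underlying simple graph, whose edges are the pairs of nonzero weight. -/
def toSimpleGraph (G : WeightedGraph V) : SimpleGraph V where
  Adj u v := G.w u v ≠ 0
  symm := ⟨fun u v h => by rwa [G.symm v u]⟩
  loopless := ⟨fun v h => h (G.loopless v)⟩

/-- The induced weighted subgraph on a set of vertices. -/
def induce (G : WeightedGraph V) (S : Set V) : WeightedGraph S where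
  w u v := G.w u v
  nonneg u v := G.nonneg u v
  symm u v := G.symm u v
  loopless v := G.loopless v
  summable v := (G.summable v).comp_injective Subtype.val_injective

theorem boundedDegree_of_finite [Finite V] (G : WeightedGraph V) : G.BoundedDegree := by
  obtain ⟨D, hD⟩ := (Set.finite_range G.deg).bddAbove
  exact ⟨D, fun v => hD ⟨v, rfl⟩⟩

theorem deg_nonneg (G : WeightedGraph V) (v : V) : 0 ≤ G.deg v := tsum_nonneg (G.nonneg v)

theorem summable_sq (f : EllTwo V) : Summable fun v => ‖f v‖ ^ 2 := by
  have h := (lp.memℓp f).summable (by norm_num)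
  simpa using h

theorem norm_sq_eq (f : EllTwo V) : ‖f‖ ^ 2 = ∑' v, ‖f v‖ ^ 2 := by
  have h := lp.norm_rpow_eq_tsum (p := 2) (by norm_num) f
  simpa using h

/-- Summability of the gradient of a square summable function. -/
theorem summable_grad (G : WeightedGraph V) {D : ℝ} (hD : ∀ v, G.deg v ≤ D) (f : EllTwo V) :
    Summable (fun p : V × V => G.w p.1 p.2 * ‖f p.1 - f p.2‖ ^ 2) ∧
      ∑' p : V × V, G.w p.1 p.2 * ‖f p.1 - f p.2‖ ^ 2 ≤ 4 * D * ‖f‖ ^ 2 := by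
  have hdf : Summable fun v => G.deg v * ‖f v‖ ^ 2 :=
    Summable.of_nonneg_of_le (fun v => mul_nonneg (G.deg_nonneg v) (sq_nonneg _))
      (fun v => mul_le_mul_of_nonneg_right (hD v) (sq_nonneg _)) ((summable_sq f).mul_left D)
  have hrow : ∀ v, ∑' u, G.w v u * ‖f v‖ ^ 2 = G.deg v * ‖f v‖ ^ 2 := fun v => by
    rw [tsum_mul_right, deg]
  have hF : Summable fun p : V × V => G.w p.1 p.2 * ‖f p.1‖ ^ 2 := by
    refine (summable_prod_of_nonneg (f := fun p : V × V => G.w p.1 p.2 * ‖f p.1‖ ^ 2)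
      (fun p => mul_nonneg (G.nonneg p.1 p.2) (sq_nonneg ‖f p.1‖))).2
      ⟨fun v => (G.summable v).mul_right (‖f v‖ ^ 2), ?_⟩
    exact hdf.congr fun v => (hrow v).symm
  have hFle : ∑' p : V × V, G.w p.1 p.2 * ‖f p.1‖ ^ 2 ≤ D * ‖f‖ ^ 2 := by
    have h1 : ∑' p : V × V, G.w p.1 p.2 * ‖f p.1‖ ^ 2 = ∑' v, G.deg v * ‖f v‖ ^ 2 := by
      rw [hF.tsum_prod]
      exact tsum_congr hrow
    rw [h1, norm_sq_eq, ← tsum_mul_left]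
    exact hdf.tsum_le_tsum (fun v => mul_le_mul_of_nonneg_right (hD v) (sq_nonneg _))
      ((summable_sq f).mul_left D)
  have hswap : (fun p : V × V => G.w p.1 p.2 * ‖f p.2‖ ^ 2) =
      (fun p : V × V => G.w p.1 p.2 * ‖f p.1‖ ^ 2) ∘ Equiv.prodComm V V := by
    funext p
    simp [G.symm p.1 p.2]
  have hF' : Summable fun p : V × V => G.w p.1 p.2 * ‖f p.2‖ ^ 2 := by
    rw [hswap]
    exact (Equiv.summable_iff _).2 hF
  have hF'eq : ∑' p : V × V, G.w p.1 p.2 * ‖f p.2‖ ^ 2 =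
      ∑' p : V × V, G.w p.1 p.2 * ‖f p.1‖ ^ 2 := by
    rw [hswap]
    exact (Equiv.prodComm V V).tsum_eq (fun p : V × V => G.w p.1 p.2 * ‖f p.1‖ ^ 2)
  have hle : ∀ p : V × V, G.w p.1 p.2 * ‖f p.1 - f p.2‖ ^ 2 ≤
      2 * (G.w p.1 p.2 * ‖f p.1‖ ^ 2) + 2 * (G.w p.1 p.2 * ‖f p.2‖ ^ 2) := by
    intro p
    have h1 : ‖f p.1 - f p.2‖ ^ 2 ≤ (‖f p.1‖ + ‖f p.2‖) ^ 2 :=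
      pow_le_pow_left₀ (norm_nonneg _) (norm_sub_le _ _) 2
    have h2 : ‖f p.1 - f p.2‖ ^ 2 ≤ 2 * ‖f p.1‖ ^ 2 + 2 * ‖f p.2‖ ^ 2 := by
      nlinarith [sq_nonneg (‖f p.1‖ - ‖f p.2‖)]
    nlinarith [mul_le_mul_of_nonneg_left h2 (G.nonneg p.1 p.2)]
  have hS := (hF.mul_left 2).add (hF'.mul_left 2)
  have hK := Summable.of_nonneg_of_le
    (fun p : V × V => mul_nonneg (G.nonneg p.1 p.2) (sq_nonneg ‖f p.1 - f p.2‖)) hle hS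
  refine ⟨hK, (hK.tsum_le_tsum hle hS).trans ?_⟩
  rw [(hF.mul_left 2).tsum_add (hF'.mul_left 2), tsum_mul_left, tsum_mul_left, hF'eq]
  linarith

/-- Pointwise convergence of the Laplacian, with a bound by the Cauchy-Schwarz inequality. -/
theorem summable_lap (G : WeightedGraph V) {D : ℝ} (hD : ∀ v, G.deg v ≤ D) (f : EllTwo V)
    (v : V) : Summable (fun u => (f v - f u) * (G.w v u : ℂ)) ∧
      ‖∑' u, (f v - f u) * (G.w v u : ℂ)‖ ^ 2 ≤ D * ∑' u, G.w v u * ‖f v - f u‖ ^ 2 := by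
  have hrow : Summable fun u => G.w v u * ‖f v - f u‖ ^ 2 :=
    (G.summable_grad hD f).1.prod_factor v
  have hR : 0 ≤ ∑' u, G.w v u * ‖f v - f u‖ ^ 2 :=
    tsum_nonneg fun u => mul_nonneg (G.nonneg _ _) (sq_nonneg _)
  have hD0 : 0 ≤ D := (G.deg_nonneg v).trans (hD v)
  have hn : ∀ u, ‖(f v - f u) * (G.w v u : ℂ)‖ = G.w v u * ‖f v - f u‖ := fun u => by
    rw [norm_mul, Complex.norm_real, Real.norm_of_nonneg (G.nonneg v u), mul_comm]
  have hfin : ∀ s : Finset V, ∑ u ∈ s, ‖(f v - f u) * (G.w v u : ℂ)‖ ≤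
      Real.sqrt (D * ∑' u, G.w v u * ‖f v - f u‖ ^ 2) := by
    intro s
    apply Real.le_sqrt_of_sq_le
    refine (Finset.sum_sq_le_sum_mul_sum_of_sq_le_mul s (fun u _ => G.nonneg v u)
      (fun u _ => mul_nonneg (G.nonneg v u) (sq_nonneg ‖f v - f u‖))
      (fun u _ => le_of_eq (by rw [hn]; ring))).trans ?_
    exact mul_le_mul
      (((G.summable v).sum_le_tsum s fun u _ => G.nonneg v u).trans (hD v))
      (hrow.sum_le_tsum s fun u _ => mul_nonneg (G.nonneg v u) (sq_nonneg _))
      (Finset.sum_nonneg fun u _ => mul_nonneg (G.nonneg v u) (sq_nonneg _)) hD0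
  have hs : Summable fun u => ‖(f v - f u) * (G.w v u : ℂ)‖ :=
    summable_of_sum_le (fun _ => norm_nonneg _) hfin
  refine ⟨hs.of_norm, ?_⟩
  have h1 : ‖∑' u, (f v - f u) * (G.w v u : ℂ)‖ ≤
      Real.sqrt (D * ∑' u, G.w v u * ‖f v - f u‖ ^ 2) :=
    (norm_tsum_le_tsum_norm hs).trans (hs.tsum_le_of_sum_le hfin)
  calc ‖∑' u, (f v - f u) * (G.w v u : ℂ)‖ ^ 2
      ≤ Real.sqrt (D * ∑' u, G.w v u * ‖f v - f u‖ ^ 2) ^ 2 :=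
        pow_le_pow_left₀ (norm_nonneg _) h1 2
    _ = _ := Real.sq_sqrt (mul_nonneg hD0 hR)

theorem summable_lap_sq (G : WeightedGraph V) {D : ℝ} (hD : ∀ v, G.deg v ≤ D) (f : EllTwo V) :
    Summable (fun v => ‖∑' u, (f v - f u) * (G.w v u : ℂ)‖ ^ 2) ∧
      ∑' v, ‖∑' u, (f v - f u) * (G.w v u : ℂ)‖ ^ 2 ≤ D * (4 * D * ‖f‖ ^ 2) := by
  obtain ⟨hK, hKle⟩ := G.summable_grad hD f
  have hsum := hK.prod.mul_left D
  have h := Summable.of_nonneg_of_le (fun v => sq_nonneg _)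
    (fun v => (G.summable_lap hD f v).2) hsum
  refine ⟨h, (h.tsum_le_tsum (fun v => (G.summable_lap hD f v).2) hsum).trans ?_⟩
  rw [tsum_mul_left, ← hK.tsum_prod]
  rcases isEmpty_or_nonempty V with hV | ⟨⟨v⟩⟩
  · have : f = 0 := by
      ext v
      exact hV.elim v
    simp [this]
  · exact mul_le_mul_of_nonneg_left hKle ((G.deg_nonneg v).trans (hD v))

theorem exists_bound (G : WeightedGraph V) (hG : G.BoundedDegree) :
    ∃ D : ℝ, 0 ≤ D ∧ ∀ v, G.deg v ≤ D := by
  obtain ⟨D, hD⟩ := hG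
  exact ⟨max D 0, le_max_right _ _, fun v => (hD v).trans (le_max_left _ _)⟩

/-- The Laplacian `(L f)(v) = ∑ u, (f v - f u) w(v, u)` of a weighted graph with bounded degrees,
as a linear map on `ℓ²`. -/
def laplacianLin (G : WeightedGraph V) (hG : G.BoundedDegree) : EllTwo V →ₗ[ℂ] EllTwo V where
  toFun f := ⟨fun v => ∑' u, (f v - f u) * (G.w v u : ℂ), by
    obtain ⟨D, hD⟩ := hG
    refine memℓp_gen ?_
    simpa using (G.summable_lap_sq hD f).1⟩
  map_add' f g := by
    obtain ⟨D, hD⟩ := hG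
    ext v
    change ∑' u, ((f + g : EllTwo V) v - (f + g : EllTwo V) u) * (G.w v u : ℂ) =
      ∑' u, (f v - f u) * (G.w v u : ℂ) + ∑' u, (g v - g u) * (G.w v u : ℂ)
    rw [← (G.summable_lap hD f v).1.tsum_add (G.summable_lap hD g v).1]
    refine tsum_congr fun u => ?_
    rw [lp.coeFn_add, Pi.add_apply, Pi.add_apply]
    ring
  map_smul' a f := by
    ext v
    change ∑' u, ((a • f : EllTwo V) v - (a • f : EllTwo V) u) * (G.w v u : ℂ) =
      a * ∑' u, (f v - f u) * (G.w v u : ℂ)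
    rw [← tsum_mul_left]
    refine tsum_congr fun u => ?_
    rw [lp.coeFn_smul, Pi.smul_apply, Pi.smul_apply, smul_eq_mul, smul_eq_mul]
    ring

/-- The Laplacian of a weighted graph with bounded degrees, as a bounded operator on `ℓ²`. -/
def laplacian (G : WeightedGraph V) (hG : G.BoundedDegree) : EllTwo V →L[ℂ] EllTwo V :=
  (G.laplacianLin hG).mkContinuousOfExistsBound (by
    obtain ⟨D, hD0, hD⟩ := G.exists_bound hG
    refine ⟨2 * D, fun f => ?_⟩
    refine le_of_sq_le_sq ?_ (by positivity)
    rw [norm_sq_eq]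
    refine (G.summable_lap_sq hD f).2.trans (le_of_eq ?_)
    ring)

theorem laplacian_apply (G : WeightedGraph V) (hG : G.BoundedDegree) (f : EllTwo V) (v : V) :
    G.laplacian hG f v = ∑' u, (f v - f u) * (G.w v u : ℂ) := rfl

/-- The first nonzero eigenvalue of the Laplacian of a finite weighted graph. -/
def firstEigenvalue [Finite V] (G : WeightedGraph V) : ℝ :=
  sInf {l : ℝ | l ≠ 0 ∧ Module.End.HasEigenvalue
    (G.laplacian G.boundedDegree_of_finite).toLinearMap (l : ℂ)}

end WeightedGraph

/-- The characteristic function of a finite set of vertices, as an element of `ℓ²`. -/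
def charFun {V : Type*} (S : Finset V) : EllTwo V :=
  ⟨Set.indicator (S : Set V) 1, by
    refine memℓp_gen (summable_of_ne_finset_zero (s := S) fun v hv => ?_)
    simp [hv]⟩

/-- The functional `Ψ f = ⟨f, ψ⟩ = ∑ v, f v * conj (ψ v)` (Mathlib's inner product is linear in
the second variable). -/
def functional {V : Type*} (ψ f : EllTwo V) : ℂ := inner ℂ ψ f

/-- The number `θ = |S| ‖ψ‖² / |Ψ(χ_S)|²`. -/
def thetaConst {V : Type*} (S : Finset V) (ψ : EllTwo V) : ℝ :=
  (S.card : ℝ) * ‖ψ‖ ^ 2 / ‖functional ψ (charFun S)‖ ^ 2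

/-- `Θ`, the supremum of the numbers `θ_j`. -/
def bigTheta {V J : Type*} (S : J → Finset V) (ψ : J → EllTwo V) : ℝ :=
  ⨆ j, thetaConst (S j) (ψ j)

/-- `Λ`, the infimum of the first nonzero eigenvalues of the induced subgraphs on the `S j`. -/
def bigLambda {V J : Type*} (G : WeightedGraph V) (S : J → Finset V) : ℝ :=
  ⨅ j, (G.induce (S j : Set V)).firstEigenvalue

section Spectral

variable {H : Type*} [NormedAddCommGroup H] [InnerProductSpace ℂ H] [CompleteSpace H]

/-- Continuous functions that equal `1` on `[0, ω]` and decrease pointwise, as `n → ∞`, to the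
indicator function of `[0, ω]` (for `0 ≤ ω`). -/
def cutoff (ω : ℝ) (n : ℕ) (x : ℝ) : ℝ := max 0 (1 - n * Metric.infDist x (Set.Icc 0 ω))

/-- The Paley-Wiener space of a bounded self-adjoint nonnegative operator `A`: the image of the
spectral projection `1_{[0, ω]}(A)`. This projection is the strong limit of the operators
`cutoff ω n (A)`, formed by the continuous functional calculus. -/
def paleyWiener (A : H →L[ℂ] H) (ω : ℝ) : Submodule ℂ H where
  carrier := {f | ∃ h : H, Tendsto (fun n : ℕ => cfc (cutoff ω n) A h) atTop (𝓝 f)}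
  zero_mem' := ⟨0, by simp⟩
  add_mem' := by
    rintro a b ⟨h, hh⟩ ⟨k, hk⟩
    exact ⟨h + k, by simpa using hh.add hk⟩
  smul_mem' := by
    rintro c a ⟨h, hh⟩
    exact ⟨c • h, by simpa using hh.const_smul c⟩

/-- The functionals `f ↦ ⟨f, ξ i⟩` form a frame on the subspace `K`. -/
def IsFrameOn {ι : Type*} (K : Submodule ℂ H) (ξ : ι → H) : Prop :=
  ∃ A B : ℝ, 0 < A ∧ 0 < B ∧ ∀ f ∈ K, Summable (fun i => ‖(inner ℂ (ξ i) f : ℂ)‖ ^ 2) ∧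
    A * ‖f‖ ^ 2 ≤ ∑' i, ‖(inner ℂ (ξ i) f : ℂ)‖ ^ 2 ∧
    ∑' i, ‖(inner ℂ (ξ i) f : ℂ)‖ ^ 2 ≤ B * ‖f‖ ^ 2

end Spectral

end

/-! ### Dirichlet energy and the spectral gap of a finite connected graph -/

namespace WeightedGraph

variable {V : Type*}

/-! The quadratic form of `L` is the Dirichlet energy `E(f)`, half the sum of `w(u,v)|f(u) - f(v)|²`
over ordered pairs, and membership in the Paley-Wiener space forces `E(f) ≤ ω‖f‖²`.

Lower bound. On each `S_j` the spectral gap bounds the deviation of `f` from its mean by the local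
energy (`poincare_induce`). Replacing the mean by `m_j = Ψ_j(f)/Ψ_j(χ_j)` costs only the factor
`θ_j` (`sum_norm_sub_functional_le`). Split `|f|² ≤ (1+ε)|f - m_j|² + ((1+ε)/ε)|m_j|²` on `S_j` and
sum over the cover. Edge-disjointness keeps the sum of local energies below `E(f)`, so `‖f‖² ≤ γ‖f‖²
+ ((1+ε)c/ε) ∑|Ψ_j(f)|²`, and `γ < 1` lets the first term be absorbed.

Upper bound. Cauchy-Schwarz gives `|Ψ_j(f)|² ≤ C ∑_{S_j}|f|²`, so it remains to bound the overlap of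
the cover. By `firstEigenvalue_induce_le`, a vertex of `S_j` has degree at least `Λ/2` inside `S_j`.
Different sets use different edges, so these degrees add up to at most the degree bound `D`, and no
vertex lies in more than `2D/Λ` sets. Disjoint sets have overlap one, whence the constant `C`. -/

theorem summable_weight_mul_sq (G : WeightedGraph V) {D : ℝ} (hD : ∀ v, G.deg v ≤ D)
    (f : EllTwo V) : Summable (fun p : V × V => G.w p.1 p.2 * ‖f p.1‖ ^ 2) ∧
      ∑' p : V × V, G.w p.1 p.2 * ‖f p.1‖ ^ 2 ≤ D * ‖f‖ ^ 2 := by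
  have hdf : Summable fun v => G.deg v * ‖f v‖ ^ 2 :=
    Summable.of_nonneg_of_le (fun v => mul_nonneg (G.deg_nonneg v) (sq_nonneg _))
      (fun v => mul_le_mul_of_nonneg_right (hD v) (sq_nonneg _)) ((summable_sq f).mul_left D)
  have hrow : ∀ v, ∑' u, G.w v u * ‖f v‖ ^ 2 = G.deg v * ‖f v‖ ^ 2 := fun v => by
    rw [tsum_mul_right, deg]
  have hF : Summable fun p : V × V => G.w p.1 p.2 * ‖f p.1‖ ^ 2 :=
    (summable_prod_of_nonneg (f := fun p : V × V => G.w p.1 p.2 * ‖f p.1‖ ^ 2)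
      (fun p => mul_nonneg (G.nonneg p.1 p.2) (sq_nonneg ‖f p.1‖))).2
      ⟨fun v => (G.summable v).mul_right (‖f v‖ ^ 2), hdf.congr fun v => (hrow v).symm⟩
  refine ⟨hF, ?_⟩
  rw [hF.tsum_prod, tsum_congr hrow, norm_sq_eq, ← tsum_mul_left]
  exact hdf.tsum_le_tsum (fun v => mul_le_mul_of_nonneg_right (hD v) (sq_nonneg _))
    ((summable_sq f).mul_left D)

/-- The Dirichlet energy of a function on the vertices. -/
noncomputable def energy (G : WeightedGraph V) (f : V → ℂ) : ℝ :=
  (∑' p : V × V, G.w p.1 p.2 * ‖f p.1 - f p.2‖ ^ 2) / 2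

theorem energy_nonneg (G : WeightedGraph V) (f : V → ℂ) : 0 ≤ G.energy f :=
  div_nonneg (tsum_nonneg fun _ => mul_nonneg (G.nonneg _ _) (sq_nonneg _)) zero_le_two

/-- Green's formula: the double series converges absolutely, so it may be averaged with its image
under swapping the two vertices, which turns each term into a squared difference. -/
theorem inner_laplacian_self (G : WeightedGraph V) (hG : G.BoundedDegree) (f : EllTwo V) :
    inner ℂ f (G.laplacian hG f) = (G.energy f : ℂ) := by
  obtain ⟨D, hD⟩ := id hG
  have hK := (G.summable_grad hD f).1
  have hF := (G.summable_weight_mul_sq hD f).1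
  set F : V × V → ℂ := fun p => (f p.1 - f p.2) * (G.w p.1 p.2 : ℂ) * starRingEnd ℂ (f p.1)
    with hFdef
  have hFs : Summable F := by
    refine Summable.of_norm_bounded (hK.add hF) fun p => ?_
    rw [hFdef]
    simp only [norm_mul, Complex.norm_real, Real.norm_of_nonneg (G.nonneg p.1 p.2),
      RCLike.norm_conj]
    have := G.nonneg p.1 p.2
    have h2 : ‖f p.1 - f p.2‖ * ‖f p.1‖ ≤ ‖f p.1 - f p.2‖ ^ 2 + ‖f p.1‖ ^ 2 := by
      nlinarith [sq_nonneg (‖f p.1 - f p.2‖ - ‖f p.1‖), sq_nonneg ‖f p.1 - f p.2‖,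
        sq_nonneg ‖f p.1‖]
    nlinarith [mul_le_mul_of_nonneg_left h2 this]
  have h1 : inner ℂ f (G.laplacian hG f) = ∑' p, F p := by
    rw [lp.inner_eq_tsum, hFs.tsum_prod]
    refine tsum_congr fun v => ?_
    rw [RCLike.inner_apply, laplacian_apply, ← tsum_mul_right]
  have h2 : ∑' p, F p = ∑' p, F (Equiv.prodComm V V p) :=
    ((Equiv.prodComm V V).tsum_eq F).symm
  have hFs' : Summable fun p => F (Equiv.prodComm V V p) :=
    (Equiv.summable_iff (Equiv.prodComm V V)).2 hFs
  have h3 : 2 * ∑' p, F p = ((∑' p : V × V, G.w p.1 p.2 * ‖f p.1 - f p.2‖ ^ 2 : ℝ) : ℂ) := by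
    rw [two_mul]
    nth_rewrite 2 [h2]
    rw [← hFs.tsum_add hFs', Complex.ofReal_tsum]
    refine tsum_congr fun p => ?_
    simp only [hFdef, Equiv.prodComm_apply, Prod.fst_swap, Prod.snd_swap, G.symm p.2 p.1]
    push_cast
    rw [← Complex.mul_conj', map_sub]
    ring
  rw [h1, energy, Complex.ofReal_div, ← h3]
  push_cast
  ring

theorem isSymmetric_laplacian (G : WeightedGraph V) (hG : G.BoundedDegree) :
    (G.laplacian hG).toLinearMap.IsSymmetric := by
  rw [LinearMap.isSymmetric_iff_inner_map_self_real]
  intro f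
  rw [← inner_conj_symm, ContinuousLinearMap.coe_coe, inner_laplacian_self]
  simp

theorem isSelfAdjoint_laplacian (G : WeightedGraph V) (hG : G.BoundedDegree) :
    IsSelfAdjoint (G.laplacian hG) :=
  ContinuousLinearMap.isSelfAdjoint_iff_isSymmetric.2 (G.isSymmetric_laplacian hG)

instance [Finite V] : FiniteDimensional ℂ (EllTwo V) :=
  FiniteDimensional.of_injective
    ({ toFun := fun f => (f : V → ℂ), map_add' := fun _ _ => rfl, map_smul' := fun _ _ => rfl } :
      EllTwo V →ₗ[ℂ] V → ℂ) (fun _ _ h => lp.ext h)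

/-- Zero energy kills the difference across every edge, and equality propagates along walks. -/
theorem eq_of_energy_eq_zero (G : WeightedGraph V) (hG : G.BoundedDegree)
    (hconn : G.toSimpleGraph.Connected) (f : EllTwo V) (h : G.energy f = 0) (u v : V) :
    f u = f v := by
  obtain ⟨D, hD⟩ := hG
  have hK := (G.summable_grad hD f).1
  have h0 : ∑' p : V × V, G.w p.1 p.2 * ‖f p.1 - f p.2‖ ^ 2 = 0 := by
    rw [energy] at h
    linarith
  have hp0 : ∀ p : V × V, 0 ≤ G.w p.1 p.2 * ‖f p.1 - f p.2‖ ^ 2 := fun p =>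
    mul_nonneg (G.nonneg p.1 p.2) (sq_nonneg _)
  have hz : ∀ p : V × V, G.w p.1 p.2 * ‖f p.1 - f p.2‖ ^ 2 = 0 := fun p =>
    le_antisymm ((hK.le_tsum p fun q _ => hp0 q).trans h0.le) (hp0 p)
  obtain ⟨p⟩ := hconn.preconnected u v
  induction p with
  | nil => rfl
  | @cons a b _ hab _ ih =>
    refine Eq.trans ?_ ih
    have := hz (a, b)
    rcases mul_eq_zero.1 this with h | h
    · exact absurd h hab
    · exact sub_eq_zero.1 (norm_eq_zero.1 (pow_eq_zero_iff two_ne_zero |>.1 h))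

/-- The Poincaré inequality on a finite connected graph. -/
theorem firstEigenvalue_mul_le_energy [Fintype V] (G : WeightedGraph V)
    (hconn : G.toSimpleGraph.Connected) (g : V → ℂ) (hg : ∑ v, g v = 0) :
    G.firstEigenvalue * ∑ v, ‖g v‖ ^ 2 ≤ G.energy g := by
  set hG := G.boundedDegree_of_finite
  set T := (G.laplacian hG).toLinearMap
  have hsym : T.IsSymmetric := G.isSymmetric_laplacian hG
  let f : EllTwo V := ⟨g, memℓp_gen (Summable.of_finite)⟩
  let b := hsym.eigenvectorBasis rfl
  have hcoef : ∀ i, inner ℂ (b i) (T f) = (hsym.eigenvalues rfl i : ℂ) * inner ℂ (b i) f := by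
    intro i
    rw [← hsym (b i) f]
    erw [hsym.apply_eigenvectorBasis rfl i]
    rw [inner_smul_left]
    simp [b]
  have hen : ∀ i, G.energy (b i) = hsym.eigenvalues rfl i := by
    intro i
    have h := G.inner_laplacian_self hG (b i)
    have h2 : G.laplacian hG (b i) = (hsym.eigenvalues rfl i : ℂ) • b i :=
      hsym.apply_eigenvectorBasis rfl i
    rw [h2, inner_smul_right, inner_self_eq_norm_sq_to_K, b.norm_eq_one] at h
    have h' := congrArg Complex.re h
    simpa using h'.symm
  have hlow : ∀ i, G.firstEigenvalue * ‖inner ℂ (b i) f‖ ^ 2 ≤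
      hsym.eigenvalues rfl i * ‖inner ℂ (b i) f‖ ^ 2 := by
    intro i
    -- Eigenvectors for the eigenvalue 0 are constant, hence orthogonal to the mean-zero `g`. Every
    -- other eigenvalue belongs to the set whose infimum is `firstEigenvalue`, and that set is
    -- bounded below by 0 because energies are nonnegative.
    by_cases h0 : hsym.eigenvalues rfl i = 0
    · have hconst := G.eq_of_energy_eq_zero hG hconn (b i) ((hen i).trans h0)
      have : inner ℂ (b i) f = 0 := by
        obtain ⟨v0⟩ := hconn.nonempty
        rw [lp.inner_eq_tsum, tsum_fintype]
        calc ∑ v, inner ℂ ((b i) v) (f v) = ∑ v, g v * starRingEnd ℂ ((b i) v0) :=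
              Finset.sum_congr rfl fun v _ => by
                rw [RCLike.inner_apply, hconst v v0]
          _ = 0 := by rw [← Finset.sum_mul, hg, zero_mul]
      rw [this]
      simp
    · refine mul_le_mul_of_nonneg_right (csInf_le ⟨0, ?_⟩ ⟨h0, ?_⟩) (sq_nonneg _)
      · rintro l ⟨-, hl⟩
        obtain ⟨x, hx⟩ := hl.exists_hasEigenvector
        have h1 : G.laplacian hG x = (l : ℂ) • x := hx.apply_eq_smul
        have h2 := G.inner_laplacian_self hG x
        rw [h1, inner_smul_right, inner_self_eq_norm_sq_to_K] at h2
        have h3 : l * ‖x‖ ^ 2 = G.energy x := by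
          apply Complex.ofReal_injective
          push_cast
          exact h2
        have h4 : 0 < ‖x‖ ^ 2 := pow_pos (norm_pos_iff.2 hx.2) 2
        by_contra hneg
        have := G.energy_nonneg x
        nlinarith [mul_neg_of_neg_of_pos (not_le.1 hneg) h4]
      · exact hsym.hasEigenvalue_eigenvalues rfl i
  have hnorm : ∑ v, ‖g v‖ ^ 2 = ∑ i, ‖inner ℂ (b i) f‖ ^ 2 := by
    rw [b.sum_sq_norm_inner_right f, norm_sq_eq, tsum_fintype]
  have henergy : G.energy g = ∑ i, hsym.eigenvalues rfl i * ‖inner ℂ (b i) f‖ ^ 2 := by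
    have h := G.inner_laplacian_self hG f
    rw [← b.sum_inner_mul_inner f] at h
    have h2 : ∀ i, inner ℂ f (b i) * inner ℂ (b i) (G.laplacian hG f) =
        ((hsym.eigenvalues rfl i * ‖inner ℂ (b i) f‖ ^ 2 : ℝ) : ℂ) := by
      intro i
      have h3 : inner ℂ (b i) (G.laplacian hG f) = _ := hcoef i
      rw [h3, ← inner_conj_symm f (b i)]
      push_cast
      rw [← Complex.conj_mul']
      ring
    rw [Finset.sum_congr rfl fun i _ => h2 i, ← Complex.ofReal_sum] at h
    exact (Complex.ofReal_injective h).symm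
  rw [hnorm, henergy, Finset.mul_sum]
  exact Finset.sum_le_sum fun i _ => hlow i

end WeightedGraph

/-! ### Bernstein-type bound on the Paley-Wiener space -/

section Spectral

variable {H : Type*} [NormedAddCommGroup H] [InnerProductSpace ℂ H] [CompleteSpace H]

theorem continuous_cutoff (ω : ℝ) (n : ℕ) : Continuous (cutoff ω n) := by
  unfold cutoff
  fun_prop

/-- The cutoff vanishes beyond distance `1/(n+1)` from `[0, ω]`. The index starts at 1 because
`cutoff ω 0` is constantly 1. -/
theorem mul_cutoff_sq_le {ω : ℝ} (hω : 0 ≤ ω) (n : ℕ) (x : ℝ) :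
    x * cutoff ω (n + 1) x ^ 2 ≤ (ω + 1 / (n + 1)) * cutoff ω (n + 1) x ^ 2 := by
  by_cases hx : x ≤ ω + 1 / (n + 1)
  · exact mul_le_mul_of_nonneg_right hx (sq_nonneg _)
  · have hx := not_le.1 hx
    have hn : (0 : ℝ) < n + 1 := by positivity
    have hd : 1 / ((n : ℝ) + 1) ≤ Metric.infDist x (Set.Icc 0 ω) := by
      refine (Metric.le_infDist ⟨0, by simp [hω]⟩).2 fun y hy => ?_
      rw [Real.dist_eq]
      exact le_trans (by linarith [hy.2]) (le_abs_self _)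
    have h0 : cutoff ω (n + 1) x = 0 := by
      unfold cutoff
      refine max_eq_left ?_
      rw [div_le_iff₀ hn] at hd
      push_cast
      linarith
    simp [h0]

/-- By monotonicity of the functional calculus, the scalar bound `mul_cutoff_sq_le` becomes `c(A) A
c(A) ≤ (ω + 1/(n+1)) c(A)²`, which is then evaluated at `h`. -/
theorem re_inner_cfc_cutoff_le (A : H →L[ℂ] H) (hA : IsSelfAdjoint A) {ω : ℝ} (hω : 0 ≤ ω)
    (n : ℕ) (h : H) :
    (inner ℂ (cfc (cutoff ω (n + 1)) A h) (A (cfc (cutoff ω (n + 1)) A h))).re ≤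
      (ω + 1 / (n + 1)) * ‖cfc (cutoff ω (n + 1)) A h‖ ^ 2 := by
  set c := cutoff ω (n + 1)
  have hc : Continuous c := continuous_cutoff _ _
  have hsa : IsSelfAdjoint (cfc c A) := cfc_predicate c A
  have hmono : cfc (fun x => x * c x ^ 2) A ≤ cfc (fun x => (ω + 1 / (n + 1)) * c x ^ 2) A :=
    cfc_mono (fun x _ => mul_cutoff_sq_le hω n x)
  have e1 : cfc (fun x => x * c x ^ 2) A = cfc c A * A * cfc c A := by
    have : (fun x => x * c x ^ 2) = fun x => (c x * x) * c x := by
      funext x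
      ring
    rw [this, cfc_mul (fun x => c x * x) c A, cfc_mul c (fun x => x) A, cfc_id' ℝ A]
  have e2 : cfc (fun x => (ω + 1 / (n + 1)) * c x ^ 2) A =
      (ω + 1 / (n + 1) : ℝ) • (cfc c A * cfc c A) := by
    rw [cfc_const_mul (ω + 1 / (n + 1)) (fun x => c x ^ 2) A]
    congr 1
    rw [← cfc_mul c c A]
    congr 1
    funext x
    ring
  rw [e1, e2, ContinuousLinearMap.le_def] at hmono
  have hp := hmono.re_inner_nonneg_right h
  have hs : ∀ x y : H, inner ℂ x (cfc c A y) = inner ℂ (cfc c A x) y := fun x y =>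
    ((ContinuousLinearMap.isSelfAdjoint_iff_isSymmetric.1 hsa) x y).symm
  simp only [sub_apply, smul_apply,
    mul_apply_eq_comp, inner_sub_right, map_sub] at hp
  rw [hs, inner_smul_right_eq_smul, hs, inner_self_eq_norm_sq_to_K] at hp
  have : ((ω + 1 / (n + 1) : ℝ) • ((‖cfc c A h‖ : ℂ) ^ 2)).re =
      (ω + 1 / (n + 1)) * ‖cfc c A h‖ ^ 2 := by
    rw [Complex.smul_re, ← Complex.ofReal_pow, Complex.ofReal_re, smul_eq_mul]
  have h3 := sub_nonneg.1 hp
  exact h3.trans_eq this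

theorem re_inner_le_of_mem_paleyWiener (A : H →L[ℂ] H) (hA : IsSelfAdjoint A) {ω : ℝ}
    (hω : 0 ≤ ω) {f : H} (hf : f ∈ paleyWiener A ω) : (inner ℂ f (A f)).re ≤ ω * ‖f‖ ^ 2 := by
  obtain ⟨h, hh⟩ := hf
  have hh1 := (tendsto_add_atTop_iff_nat 1).2 hh
  have l1 : Tendsto (fun n : ℕ => (inner ℂ (cfc (cutoff ω (n + 1)) A h)
      (A (cfc (cutoff ω (n + 1)) A h))).re) atTop (𝓝 (inner ℂ f (A f)).re) :=
    (Complex.continuous_re.tendsto _).comp (hh1.inner ((A.continuous.tendsto f).comp hh1))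
  have l2 : Tendsto (fun n : ℕ => (ω + 1 / ((n : ℝ) + 1)) * ‖cfc (cutoff ω (n + 1)) A h‖ ^ 2)
      atTop (𝓝 ((ω + 0) * ‖f‖ ^ 2)) :=
    (tendsto_const_nhds.add tendsto_one_div_add_atTop_nhds_zero_nat).mul (hh1.norm.pow 2)
  rw [add_zero] at l2
  exact le_of_tendsto_of_tendsto' l1 l2 fun n => re_inner_cfc_cutoff_le A hA hω n h

end Spectral

/-! ### Averages and functionals on a finite set -/

section FiniteSums

variable {V : Type*}

theorem sum_norm_sub_const_sq (S : Finset V) (g : V → ℂ) (b : ℂ) (hg : ∑ v ∈ S, g v = 0) :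
    ∑ v ∈ S, ‖g v - b‖ ^ 2 = ∑ v ∈ S, ‖g v‖ ^ 2 + S.card * ‖b‖ ^ 2 := by
  have h : ∀ v, ‖g v - b‖ ^ 2 = ‖g v‖ ^ 2 - 2 * (g v * starRingEnd ℂ b).re + ‖b‖ ^ 2 := by
    intro v
    rw [Complex.sq_norm, Complex.sq_norm, Complex.sq_norm, Complex.normSq_sub]
    ring
  simp_rw [h]
  rw [Finset.sum_add_distrib, Finset.sum_sub_distrib, ← Finset.mul_sum, ← Complex.re_sum,
    ← Finset.sum_mul, hg]
  simp

/-- The average of a function over a finite set. -/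
noncomputable def average (S : Finset V) (f : V → ℂ) : ℂ := (∑ v ∈ S, f v) / S.card

theorem sum_sub_average (S : Finset V) (hS : S.Nonempty) (f : V → ℂ) :
    ∑ v ∈ S, (f v - average S f) = 0 := by
  have : (S.card : ℂ) ≠ 0 := by exact_mod_cast hS.card_pos.ne'
  rw [Finset.sum_sub_distrib, Finset.sum_const, nsmul_eq_mul, average, mul_div_cancel₀ _ this,
    sub_self]

theorem sum_norm_sub_average_sq (S : Finset V) (hS : S.Nonempty) (f : V → ℂ) :
    ∑ v ∈ S, ‖f v - average S f‖ ^ 2 = ∑ v ∈ S, ‖f v‖ ^ 2 - ‖∑ v ∈ S, f v‖ ^ 2 / S.card := by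
  have h := sum_norm_sub_const_sq S _ (-average S f) (sum_sub_average S hS f)
  have h0 : (S.card : ℝ) ≠ 0 := by exact_mod_cast hS.card_pos.ne'
  simp only [sub_neg_eq_add, sub_add_cancel, norm_neg] at h
  rw [h, average, norm_div, Complex.norm_natCast]
  field_simp
  ring

theorem norm_sum_mul_sq_le (S : Finset V) (g φ : V → ℂ) :
    ‖∑ v ∈ S, g v * φ v‖ ^ 2 ≤ (∑ v ∈ S, ‖g v‖ ^ 2) * ∑ v ∈ S, ‖φ v‖ ^ 2 := by
  refine le_trans (pow_le_pow_left₀ (norm_nonneg _) (norm_sum_le _ _) 2) ?_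
  simp_rw [norm_mul]
  exact Finset.sum_mul_sq_le_sq_mul_sq S _ _

theorem norm_sq_le_add {ε : ℝ} (hε : 0 < ε) (a m : ℂ) :
    ‖a‖ ^ 2 ≤ (1 + ε) * ‖a - m‖ ^ 2 + (1 + ε) / ε * ‖m‖ ^ 2 := by
  have h1 : ‖a‖ ≤ ‖a - m‖ + ‖m‖ := by simpa using norm_add_le (a - m) m
  have h2 : ‖a‖ ^ 2 ≤ (‖a - m‖ + ‖m‖) ^ 2 := pow_le_pow_left₀ (norm_nonneg _) h1 2
  have h3 : (1 + ε) * ‖a - m‖ ^ 2 + (1 + ε) / ε * ‖m‖ ^ 2 - (‖a - m‖ + ‖m‖) ^ 2 =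
      (ε * ‖a - m‖ - ‖m‖) ^ 2 / ε := by
    field_simp
    ring
  have h4 : 0 ≤ (ε * ‖a - m‖ - ‖m‖) ^ 2 / ε := by positivity
  linarith

/-- Replacing the average by the value of a linear functional normalised on constants. -/
theorem sum_norm_sub_functional_le (S : Finset V) (hS : S.Nonempty) (f φ : V → ℂ)
    (hφ : ∑ v ∈ S, φ v ≠ 0) :
    ∑ v ∈ S, ‖f v - (∑ u ∈ S, f u * φ u) / ∑ u ∈ S, φ u‖ ^ 2 ≤
      (S.card * (∑ v ∈ S, ‖φ v‖ ^ 2) / ‖∑ v ∈ S, φ v‖ ^ 2) *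
        ∑ v ∈ S, ‖f v - average S f‖ ^ 2 := by
  set a := average S f
  set P := ∑ v ∈ S, φ v
  set g : V → ℂ := fun v => f v - a with hg
  have hg0 : ∑ v ∈ S, g v = 0 := sum_sub_average S hS f
  have hfg : ∑ u ∈ S, f u * φ u = a * P + ∑ u ∈ S, g u * φ u := by
    rw [Finset.mul_sum, ← Finset.sum_add_distrib]
    refine Finset.sum_congr rfl fun u _ => ?_
    simp only [hg]
    ring
  -- Since `g` has mean zero, `φ` may be centred before Cauchy-Schwarz. The gain `-‖P‖²/|S|` cancels
  -- the leading `∑ ‖g v‖²` exactly at the end, so the constant is `θ` and not `1 + θ`.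
  have hgφ : ∑ u ∈ S, g u * φ u = ∑ u ∈ S, g u * (φ u - average S φ) := by
    simp_rw [mul_sub]
    rw [Finset.sum_sub_distrib, ← Finset.sum_mul, hg0, zero_mul, sub_zero]
  set b := (∑ u ∈ S, g u * φ u) / P with hb
  have h1 : ∀ v, f v - (∑ u ∈ S, f u * φ u) / P = g v - b := by
    intro v
    rw [hfg, hb, add_div, mul_div_cancel_right₀ _ hφ]
    simp only [hg]
    ring
  simp_rw [h1]
  rw [sum_norm_sub_const_sq S g b hg0]
  have hcs := norm_sum_mul_sq_le S g (fun u => φ u - average S φ)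
  rw [← hgφ, sum_norm_sub_average_sq S hS φ] at hcs
  have hn : (0 : ℝ) < S.card := by exact_mod_cast hS.card_pos
  have hP : 0 < ‖P‖ ^ 2 := pow_pos (norm_pos_iff.2 hφ) 2
  have hbn : ‖b‖ ^ 2 = ‖∑ u ∈ S, g u * φ u‖ ^ 2 / ‖P‖ ^ 2 := by
    rw [hb, norm_div, div_pow]
  rw [hbn]
  calc ∑ v ∈ S, ‖g v‖ ^ 2 + S.card * (‖∑ u ∈ S, g u * φ u‖ ^ 2 / ‖P‖ ^ 2)
      ≤ ∑ v ∈ S, ‖g v‖ ^ 2 + S.card * (((∑ v ∈ S, ‖g v‖ ^ 2) *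
        (∑ v ∈ S, ‖φ v‖ ^ 2 - ‖P‖ ^ 2 / S.card)) / ‖P‖ ^ 2) := by gcongr
    _ = _ := by
      field_simp
      ring

end FiniteSums

/-! ### Local energies and edge-disjoint covers -/

namespace WeightedGraph

variable {V : Type*}

/-- The Dirichlet energy of a function on the subgraph induced on a finite set. -/
noncomputable def localEnergy (G : WeightedGraph V) (S : Finset V) (f : V → ℂ) : ℝ :=
  (∑ p ∈ S ×ˢ S, G.w p.1 p.2 * ‖f p.1 - f p.2‖ ^ 2) / 2

theorem poincare_induce (G : WeightedGraph V) (S : Finset V)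
    (hconn : (G.toSimpleGraph.induce (S : Set V)).Connected) (f : V → ℂ) :
    (G.induce (S : Set V)).firstEigenvalue * ∑ v ∈ S, ‖f v - average S f‖ ^ 2 ≤
      G.localEnergy S f := by
  have hS : S.Nonempty := by
    obtain ⟨v⟩ := hconn.nonempty
    exact ⟨v, v.2⟩
  have hgraph : (G.induce (S : Set V)).toSimpleGraph = G.toSimpleGraph.induce (S : Set V) := rfl
  have hsub : ∀ F : V → ℝ, ∑ v : (S : Set V), F v = ∑ v ∈ S, F v := fun F =>
    Finset.sum_finset_coe F S
  have h := (G.induce (S : Set V)).firstEigenvalue_mul_le_energy (hgraph ▸ hconn)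
    (fun v => f v - average S f)
    ((Finset.sum_finset_coe (fun v => f v - average S f) S).trans (sum_sub_average S hS f))
  rw [hsub fun v => ‖f v - average S f‖ ^ 2] at h
  refine h.trans_eq ?_
  rw [energy, localEnergy, tsum_fintype, Fintype.sum_prod_type, Finset.sum_product]
  congr 1
  rw [← hsub]
  refine Finset.sum_congr rfl fun u _ => ?_
  rw [← hsub]
  refine Finset.sum_congr rfl fun v _ => ?_
  simp [induce]

/-- In an induced subgraph every vertex has degree at least half of the first eigenvalue. -/
theorem firstEigenvalue_induce_le (G : WeightedGraph V) (S : Finset V)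
    (hconn : (G.toSimpleGraph.induce (S : Set V)).Connected) (hS : 1 < S.card)
    (hl : 0 ≤ (G.induce (S : Set V)).firstEigenvalue) {v : V} (hv : v ∈ S) :
    (G.induce (S : Set V)).firstEigenvalue ≤ 2 * ∑ u ∈ S, G.w v u := by
  classical
  -- The Poincaré inequality is tested on the indicator of `v`: its variance over `S` is `1 - 1/|S|
  -- ≥ 1/2`, and its energy is at most the degree of `v` in `S`.
  set f : V → ℂ := fun u => if u = v then 1 else 0 with hf
  have h := G.poincare_induce S hconn f
  rw [sum_norm_sub_average_sq S ⟨v, hv⟩] at h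
  have h1 : ∑ u ∈ S, ‖f u‖ ^ 2 = 1 := by
    rw [Finset.sum_eq_single v (fun u _ hu => by simp [hf, hu]) (fun h => absurd hv h)]
    simp [hf]
  have h2 : ∑ u ∈ S, f u = 1 := by simp [hf, hv]
  have h3 : G.localEnergy S f ≤ ∑ u ∈ S, G.w v u := by
    have hle : ∀ p : V × V, G.w p.1 p.2 * ‖f p.1 - f p.2‖ ^ 2 ≤
        (if p.1 = v then G.w p.1 p.2 else 0) + (if p.2 = v then G.w p.1 p.2 else 0) := by
      intro p
      by_cases ha : p.1 = v <;> by_cases hb : p.2 = v <;> simp [hf, ha, hb, G.loopless]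
    have hsum : ∑ p ∈ S ×ˢ S, G.w p.1 p.2 * ‖f p.1 - f p.2‖ ^ 2 ≤ 2 * ∑ u ∈ S, G.w v u := by
      refine (Finset.sum_le_sum fun p _ => hle p).trans (le_of_eq ?_)
      rw [Finset.sum_add_distrib, Finset.sum_product, Finset.sum_product_right]
      have e1 : ∀ x ∈ S, ∑ y ∈ S, (if x = v then G.w x y else 0) =
          if x = v then ∑ y ∈ S, G.w v y else 0 := by
        intro x _
        split_ifs with hx
        · rw [hx]
        · simp
      have e2 : ∀ y ∈ S, ∑ x ∈ S, (if y = v then G.w x y else 0) =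
          if y = v then ∑ x ∈ S, G.w v x else 0 := by
        intro y _
        split_ifs with hy
        · simp_rw [hy, G.symm _ v]
        · simp
      rw [Finset.sum_congr rfl e1, Finset.sum_congr rfl e2, Finset.sum_ite_eq' S v, if_pos hv]
      ring
    rw [localEnergy]
    linarith
  rw [h1, h2] at h
  have h4 : (1 : ℝ) / S.card ≤ 1 / 2 :=
    one_div_le_one_div_of_le two_pos (by exact_mod_cast hS)
  norm_num at h
  rw [one_div] at h4
  nlinarith [h.trans h3, mul_le_mul_of_nonneg_left h4 hl]

/-- Summation of an edge function over edge-disjoint sets of vertices. -/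
theorem sum_sum_le_tsum_of_edge_disjoint {J : Type*} (G : WeightedGraph V) (S : J → Finset V)
    (hedge : ∀ i j, i ≠ j → ∀ u v, G.toSimpleGraph.Adj u v →
      ¬ ((u ∈ S i ∧ v ∈ S i) ∧ (u ∈ S j ∧ v ∈ S j)))
    (F : V × V → ℝ) (hF0 : ∀ p, 0 ≤ F p) (hFw : ∀ p, G.w p.1 p.2 = 0 → F p = 0)
    (hFs : Summable F) (T : Finset J) :
    ∑ j ∈ T, ∑ p ∈ S j ×ˢ S j, F p ≤ ∑' p, F p := by
  classical
  -- Pairs of weight zero may lie in several products `S j ×ˢ S j`, but `F` vanishes there; once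
  -- they are removed the products are pairwise disjoint.
  have h1 : ∀ j, ∑ p ∈ S j ×ˢ S j, F p =
      ∑ p ∈ (S j ×ˢ S j).filter (fun p => G.w p.1 p.2 ≠ 0), F p := by
    intro j
    rw [Finset.sum_filter]
    refine Finset.sum_congr rfl fun p _ => ?_
    split_ifs with h
    · rfl
    · exact hFw p (not_not.1 h)
  simp_rw [h1]
  rw [← Finset.sum_biUnion]
  · exact hFs.sum_le_tsum _ fun p _ => hF0 p
  · intro i _ j _ hij
    refine Finset.disjoint_left.2 fun p hp hq => ?_
    simp only [Finset.mem_filter, Finset.mem_product] at hp hq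
    exact hedge i j hij p.1 p.2 hp.2 ⟨hp.1, hq.1⟩

end WeightedGraph

/-! ### The sampling functionals on a single set -/

section Functional

variable {V : Type*}

theorem functional_eq_sum (S : Finset V) (ψ f : EllTwo V) (hψ : ∀ v, v ∉ S → ψ v = 0) :
    functional ψ f = ∑ v ∈ S, f v * starRingEnd ℂ (ψ v) := by
  rw [functional, lp.inner_eq_tsum, tsum_eq_sum (s := S)]
  · exact Finset.sum_congr rfl fun v _ => RCLike.inner_apply _ _
  · intro v hv
    simp [hψ v hv]

theorem functional_charFun (S : Finset V) (ψ : EllTwo V) (hψ : ∀ v, v ∉ S → ψ v = 0) :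
    functional ψ (charFun S) = ∑ v ∈ S, starRingEnd ℂ (ψ v) := by
  rw [functional_eq_sum S ψ _ hψ]
  refine Finset.sum_congr rfl fun v hv => ?_
  simp [charFun, hv]

theorem norm_sq_eq_sum (S : Finset V) (ψ : EllTwo V) (hψ : ∀ v, v ∉ S → ψ v = 0) :
    ‖ψ‖ ^ 2 = ∑ v ∈ S, ‖ψ v‖ ^ 2 := by
  rw [WeightedGraph.norm_sq_eq, tsum_eq_sum (s := S)]
  intro v hv
  simp [hψ v hv]

theorem norm_functional_sq_le (S : Finset V) (ψ f : EllTwo V) (hψ : ∀ v, v ∉ S → ψ v = 0) :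
    ‖functional ψ f‖ ^ 2 ≤ ‖ψ‖ ^ 2 * ∑ v ∈ S, ‖f v‖ ^ 2 := by
  rw [functional_eq_sum S ψ f hψ, norm_sq_eq_sum S ψ hψ, mul_comm]
  simpa using norm_sum_mul_sq_le S f (fun v => starRingEnd ℂ (ψ v))

theorem thetaConst_nonneg (S : Finset V) (ψ : EllTwo V) : 0 ≤ thetaConst S ψ := by
  unfold thetaConst
  positivity

theorem sum_norm_sq_le (S : Finset V) (hS : S.Nonempty) (ψ f : EllTwo V)
    (hψ : ∀ v, v ∉ S → ψ v = 0) (hne : functional ψ (charFun S) ≠ 0) {ε : ℝ} (hε : 0 < ε) :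
    ∑ v ∈ S, ‖f v‖ ^ 2 ≤
      (1 + ε) * (thetaConst S ψ * ∑ v ∈ S, ‖f v - average S f‖ ^ 2) +
      (1 + ε) / ε * (S.card / ‖functional ψ (charFun S)‖ ^ 2 * ‖functional ψ f‖ ^ 2) := by
  have hchar := functional_charFun S ψ hψ
  have h1 := sum_norm_sub_functional_le S hS f (fun v => starRingEnd ℂ (ψ v)) (hchar ▸ hne)
  simp only [RCLike.norm_conj] at h1
  rw [← hchar, ← functional_eq_sum S ψ f hψ, ← norm_sq_eq_sum S ψ hψ] at h1
  set m := functional ψ f / functional ψ (charFun S) with hm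
  calc ∑ v ∈ S, ‖f v‖ ^ 2
      ≤ ∑ v ∈ S, ((1 + ε) * ‖f v - m‖ ^ 2 + (1 + ε) / ε * ‖m‖ ^ 2) :=
        Finset.sum_le_sum fun v _ => norm_sq_le_add hε _ _
    _ = (1 + ε) * ∑ v ∈ S, ‖f v - m‖ ^ 2 + (1 + ε) / ε * (S.card * ‖m‖ ^ 2) := by
        rw [Finset.sum_add_distrib, ← Finset.mul_sum, Finset.sum_const, nsmul_eq_mul]
        ring
    _ ≤ _ := by
        have h2 : (S.card : ℝ) * ‖m‖ ^ 2 =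
            S.card / ‖functional ψ (charFun S)‖ ^ 2 * ‖functional ψ f‖ ^ 2 := by
          rw [hm, norm_div]
          ring
        rw [h2]
        have : 0 ≤ 1 + ε := by linarith
        exact add_le_add_left (mul_le_mul_of_nonneg_left h1 this) _

end Functional

/-! ### The frame inequalities -/

theorem theorem4 {V J : Type*} [Countable V]
    (G : WeightedGraph V) (hconn : G.toSimpleGraph.Connected) (hdeg : G.BoundedDegree)
    (S : J → Finset V)
    (hcover : ∀ v, ∃ j, v ∈ S j)
    (hedge : ∀ i j, i ≠ j → ∀ u v, G.toSimpleGraph.Adj u v →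
      ¬ ((u ∈ S i ∧ v ∈ S i) ∧ (u ∈ S j ∧ v ∈ S j)))
    (hcard : ∀ j, 1 < (S j).card)
    (hSconn : ∀ j, (G.toSimpleGraph.induce (S j : Set V)).Connected)
    (ψ : J → EllTwo V)
    (hsupp : ∀ j, ∀ v, v ∉ S j → ψ j v = 0)
    (hne : ∀ j, functional (ψ j) (charFun (S j)) ≠ 0)
    (hΘ : BddAbove (Set.range fun j => thetaConst (S j) (ψ j)))
    (hΛ : 0 < bigLambda G S)
    (ω ε γ c C : ℝ) (hω : 0 < ω) (hε : 0 < ε)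
    (hγ : γ = (1 + ε) * (bigTheta S ψ / bigLambda G S) * ω) (hγ1 : γ < 1)
    (hc : ∀ j, ((S j).card : ℝ) ^ 2 / ‖functional (ψ j) (charFun (S j))‖ ^ 2 ≤ c)
    (hC : ∀ j, ‖ψ j‖ ^ 2 ≤ C) :
    IsFrameOn (paleyWiener (G.laplacian hdeg) ω) ψ ∧
    ∀ f ∈ paleyWiener (G.laplacian hdeg) ω,
      Summable (fun j => ‖functional (ψ j) f‖ ^ 2) ∧
      (1 - γ) * ε / ((1 + ε) * c) * ‖f‖ ^ 2 ≤ ∑' j, ‖functional (ψ j) f‖ ^ 2 ∧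
      ((∀ i j, i ≠ j → Disjoint (S i) (S j)) →
        ∑' j, ‖functional (ψ j) f‖ ^ 2 ≤ C * ‖f‖ ^ 2) := by
  classical
  obtain ⟨D, hD0, hD⟩ := G.exists_bound hdeg
  set Λ := bigLambda G S with hΛdef
  set Θ := bigTheta S ψ with hΘdef
  have hSne : ∀ j, (S j).Nonempty := fun j => Finset.card_pos.1 (by linarith [hcard j])
  obtain ⟨v₀⟩ := hconn.nonempty
  obtain ⟨j₀, -⟩ := hcover v₀
  have hbdd : BddBelow (Set.range fun j => (G.induce (S j : Set V)).firstEigenvalue) := by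
    -- An infimum of a real family unbounded below is 0 by convention, which `0 < Λ` excludes.
    by_contra h
    rw [hΛdef, bigLambda, Real.iInf_of_not_bddBelow h] at hΛ
    exact lt_irrefl _ hΛ
  have hΛj : ∀ j, Λ ≤ (G.induce (S j : Set V)).firstEigenvalue := fun j => ciInf_le hbdd j
  have hΘj : ∀ j, thetaConst (S j) (ψ j) ≤ Θ := fun j => le_ciSup hΘ j
  have hΘ0 : 0 ≤ Θ := (thetaConst_nonneg _ _).trans (hΘj j₀)
  have hcpos : 0 < c := lt_of_lt_of_le
    (div_pos (by have := (hSne j₀).card_pos; positivity)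
      (pow_pos (norm_pos_iff.2 (hne j₀)) 2)) (hc j₀)
  have hC0 : 0 ≤ C := (sq_nonneg _).trans (hC j₀)
  -- Overlap bound: `Λ` is at most twice the degree of `v` inside `S j`, and these inner degrees sum
  -- over `j` to at most `D`.
  have hcov : ∀ (f : EllTwo V) (T : Finset J),
      ∑ j ∈ T, ∑ v ∈ S j, ‖f v‖ ^ 2 ≤ 2 * D / Λ * ‖f‖ ^ 2 := by
    intro f T
    have hs := G.summable_weight_mul_sq hD f
    have h := G.sum_sum_le_tsum_of_edge_disjoint S hedge
      (fun p => G.w p.1 p.2 * ‖f p.1‖ ^ 2) (fun p => mul_nonneg (G.nonneg _ _) (sq_nonneg _))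
      (fun p hp => by simp [hp]) hs.1 T
    have h2 : Λ * ∑ j ∈ T, ∑ v ∈ S j, ‖f v‖ ^ 2 ≤
        2 * ∑ j ∈ T, ∑ p ∈ S j ×ˢ S j, G.w p.1 p.2 * ‖f p.1‖ ^ 2 := by
      rw [Finset.mul_sum, Finset.mul_sum]
      refine Finset.sum_le_sum fun j _ => ?_
      rw [Finset.sum_product, Finset.mul_sum, Finset.mul_sum]
      refine Finset.sum_le_sum fun v hv => ?_
      have hle := (hΛj j).trans (G.firstEigenvalue_induce_le (S j) (hSconn j) (hcard j)
        (hΛ.le.trans (hΛj j)) hv)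
      refine (mul_le_mul_of_nonneg_right hle (sq_nonneg _)).trans_eq ?_
      rw [mul_assoc, Finset.sum_mul]
    rw [div_mul_eq_mul_div, le_div_iff₀ hΛ]
    linarith [hs.2]
  have hpart : ∀ (f : EllTwo V) (T : Finset J),
      ∑ j ∈ T, ‖functional (ψ j) f‖ ^ 2 ≤ C * ∑ j ∈ T, ∑ v ∈ S j, ‖f v‖ ^ 2 := by
    intro f T
    rw [Finset.mul_sum]
    refine Finset.sum_le_sum fun j _ => (norm_functional_sq_le (S j) _ f (hsupp j)).trans ?_
    exact mul_le_mul_of_nonneg_right (hC j) (Finset.sum_nonneg fun _ _ => sq_nonneg _)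
  have hfin : ∀ (f : EllTwo V) (T : Finset J),
      ∑ j ∈ T, ‖functional (ψ j) f‖ ^ 2 ≤ C * (2 * D / Λ) * ‖f‖ ^ 2 := fun f T =>
    (hpart f T).trans (by
      rw [mul_assoc]
      exact mul_le_mul_of_nonneg_left (hcov f T) hC0)
  have hsum : ∀ f : EllTwo V, Summable fun j => ‖functional (ψ j) f‖ ^ 2 := fun f =>
    summable_of_sum_le (fun _ => sq_nonneg _) (hfin f)
  have hupper : ∀ f : EllTwo V,
      ∑' j, ‖functional (ψ j) f‖ ^ 2 ≤ C * (2 * D / Λ) * ‖f‖ ^ 2 := fun f =>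
    (hsum f).tsum_le_of_sum_le (hfin f)
  have henergy : ∀ f ∈ paleyWiener (G.laplacian hdeg) ω, G.energy f ≤ ω * ‖f‖ ^ 2 := by
    intro f hf
    have h := re_inner_le_of_mem_paleyWiener _ (G.isSelfAdjoint_laplacian hdeg) hω.le hf
    rwa [G.inner_laplacian_self hdeg f, Complex.ofReal_re] at h
  have hlow : ∀ f ∈ paleyWiener (G.laplacian hdeg) ω,
      (1 - γ) * ε / ((1 + ε) * c) * ‖f‖ ^ 2 ≤ ∑' j, ‖functional (ψ j) f‖ ^ 2 := by
    intro f hf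
    have hloc : ∀ j, ∑ v ∈ S j, ‖f v‖ ^ 2 ≤ (1 + ε) * (Θ / Λ) * G.localEnergy (S j) f +
        (1 + ε) / ε * c * ‖functional (ψ j) f‖ ^ 2 := by
      intro j
      refine (sum_norm_sq_le (S j) (hSne j) (ψ j) f (hsupp j) (hne j) hε).trans ?_
      have hX : 0 ≤ ∑ v ∈ S j, ‖f v - average (S j) f‖ ^ 2 :=
        Finset.sum_nonneg fun _ _ => sq_nonneg _
      have h1 : thetaConst (S j) (ψ j) * ∑ v ∈ S j, ‖f v - average (S j) f‖ ^ 2 ≤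
          Θ / Λ * G.localEnergy (S j) f := by
        refine (mul_le_mul_of_nonneg_right (hΘj j) hX).trans ?_
        rw [div_mul_eq_mul_div, mul_div_assoc]
        refine mul_le_mul_of_nonneg_left ?_ hΘ0
        rw [le_div_iff₀ hΛ, mul_comm]
        exact (mul_le_mul_of_nonneg_right (hΛj j) hX).trans (G.poincare_induce _ (hSconn j) f)
      -- Only `|S_j|`, not its square, is needed in the numerator.
      have h2 : ((S j).card : ℝ) / ‖functional (ψ j) (charFun (S j))‖ ^ 2 ≤ c := by
        refine le_trans ?_ (hc j)
        refine div_le_div_of_nonneg_right ?_ (sq_nonneg _)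
        exact_mod_cast Nat.le_self_pow two_ne_zero _
      have hε1 : 0 ≤ 1 + ε := by linarith
      rw [mul_assoc, mul_assoc]
      exact add_le_add (mul_le_mul_of_nonneg_left h1 hε1)
        (mul_le_mul_of_nonneg_left (mul_le_mul_of_nonneg_right h2 (sq_nonneg _))
          (div_nonneg hε1 hε.le))
    have hbound : ‖f‖ ^ 2 ≤ γ * ‖f‖ ^ 2 +
        (1 + ε) / ε * c * ∑' j, ‖functional (ψ j) f‖ ^ 2 := by
      -- Assigning to each vertex one set containing it, a finite `W` is covered by the finitely
      -- many sets indexed by `W.image k`.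
      choose k hk using hcover
      rw [WeightedGraph.norm_sq_eq]
      refine (WeightedGraph.summable_sq f).tsum_le_of_sum_le fun W => ?_
      rw [← WeightedGraph.norm_sq_eq]
      set T := W.image k
      have h1 : ∑ v ∈ W, ‖f v‖ ^ 2 ≤ ∑ j ∈ T, ∑ v ∈ S j, ‖f v‖ ^ 2 := by
        rw [← Finset.sum_fiberwise_of_maps_to (fun v hv => Finset.mem_image_of_mem k hv)]
        refine Finset.sum_le_sum fun j _ =>
          Finset.sum_le_sum_of_subset_of_nonneg (fun v hv => ?_) fun _ _ _ => sq_nonneg _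
        rw [← (Finset.mem_filter.1 hv).2]
        exact hk v
      have hK := (G.summable_grad hD f).1
      have h2 : ∑ j ∈ T, G.localEnergy (S j) f ≤ G.energy f := by
        have := G.sum_sum_le_tsum_of_edge_disjoint S hedge
          (fun p => G.w p.1 p.2 * ‖f p.1 - f p.2‖ ^ 2)
          (fun p => mul_nonneg (G.nonneg _ _) (sq_nonneg _)) (fun p hp => by simp [hp]) hK T
        simp only [WeightedGraph.localEnergy, WeightedGraph.energy]
        rw [← Finset.sum_div]
        exact div_le_div_of_nonneg_right this zero_le_two
      have h3 : ∑ j ∈ T, ‖functional (ψ j) f‖ ^ 2 ≤ ∑' j, ‖functional (ψ j) f‖ ^ 2 :=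
        (hsum f).sum_le_tsum T fun _ _ => sq_nonneg _
      refine h1.trans ((Finset.sum_le_sum fun j _ => hloc j).trans ?_)
      rw [Finset.sum_add_distrib, ← Finset.mul_sum, ← Finset.mul_sum]
      refine add_le_add ?_ (mul_le_mul_of_nonneg_left h3 (by positivity))
      rw [hγ, mul_assoc _ ω]
      exact mul_le_mul_of_nonneg_left (h2.trans (henergy f hf)) (by positivity)
    have hcε : 0 < (1 + ε) * c := by positivity
    rw [div_mul_eq_mul_div, div_le_iff₀ hcε]
    have h4 : (1 - γ) * ‖f‖ ^ 2 ≤ (1 + ε) / ε * c * ∑' j, ‖functional (ψ j) f‖ ^ 2 := by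
      linarith
    calc (1 - γ) * ε * ‖f‖ ^ 2 = ε * ((1 - γ) * ‖f‖ ^ 2) := by ring
      _ ≤ ε * ((1 + ε) / ε * c * ∑' j, ‖functional (ψ j) f‖ ^ 2) :=
        mul_le_mul_of_nonneg_left h4 hε.le
      _ = _ := by field_simp
  -- The summand 1 makes the upper constant strictly positive, as `C` and `D` are only known to be
  -- nonnegative here.
  refine ⟨⟨(1 - γ) * ε / ((1 + ε) * c), C * (2 * D / Λ) + 1,
    div_pos (mul_pos (by linarith) hε) (by positivity), by positivity, fun f hf =>
      ⟨hsum f, hlow f hf, (hupper f).trans ?_⟩⟩, fun f hf => ⟨hsum f, hlow f hf, fun hdisj => ?_⟩⟩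
  · exact mul_le_mul_of_nonneg_right (by linarith) (sq_nonneg _)
  · refine (hsum f).tsum_le_of_sum_le fun T => (hpart f T).trans ?_
    refine mul_le_mul_of_nonneg_left ?_ hC0
    rw [← Finset.sum_biUnion fun i _ j _ hij => hdisj i j hij, WeightedGraph.norm_sq_eq]
    exact (WeightedGraph.summable_sq f).sum_le_tsum _ fun _ _ => sq_nonneg _
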